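/- For $n\ge 1$ let $S_n$ be the $n$-dimensional star graph: its vertices are the permutations $p_1p_2\cdots p_n$ of $\{1,\dots,n\}$, and two vertices are adjacent if and only if one is obtained from the other by swapping the first digit and the $i$-th digit for some $i\in\{2,\dots,n\}$. (So $S_1$ is a single vertex.) Let $1\le h\le n-1$. A set $F$ of vertices (respectively, of edges) of $S_n$ is an $h$-embedded vertex-cut (respectively, $h$-embedded edge-cut) of $S_n$ if $S_n-F$ is disconnected and each vertex of $S_n-F$ is contained in a subgraph of $S_n-F$ isomorphic to $S_h$. Let $\zeta_h(S_n)$ (respectively, $\eta_h(S_n)$) be the minimum cardinality of an $h$-embedded vertex-cut (respectively, $h$-embedded edge-cut) of $S_n$. Theorem. For all integers $n$ and $h$ with $1\le h\le n-1$, an $h$-embedded edge-cut of $S_n$ exists and $$\eta_h(S_n)=h!\,(n-h).$$ If moreover $n\ge 3$, that is, $(n,h)\ne(2,1)$, then an $h$-embedded vertex-cut of $S_n$ exists and $$\zeta_h(S_n)=h!\,(n-h).$$ -/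

import Mathlib

open scoped Nat

/-- The `n`-dimensional star graph `S_n`. A vertex is a permutation `p`, read as the word
`p 0, p 1, …, p (n-1)` (positions and digits are numbered from `0`). Two vertices are adjacent
iff one is obtained from the other by swapping the digit in the first position `i` (that is,
`i = 0`) with the digit in some other position `j`. -/
def starGraph (n : ℕ) : SimpleGraph (Equiv.Perm (Fin n)) where
  Adj p q := ∃ i j : Fin n, (i : ℕ) = 0 ∧ (j : ℕ) ≠ 0 ∧ q = p * Equiv.swap i j
  symm := ⟨by
    rintro p q ⟨i, j, hi, hj, rfl⟩
    exact ⟨i, j, hi, hj, by rw [mul_assoc, Equiv.swap_mul_self, mul_one]⟩⟩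
  loopless := ⟨by
    rintro p ⟨i, j, hi, hj, h⟩
    have h1 : Equiv.swap i j = 1 := by simpa using h.symm
    have h2 : i = j := Equiv.swap_eq_one_iff.mp h1
    exact hj (h2 ▸ hi)⟩

/-- Every vertex of `G` lies in a subgraph of `G` isomorphic to `H`. -/
def EveryVertexInCopy {W V : Type*} (H : SimpleGraph W) (G : SimpleGraph V) : Prop :=
  ∀ v : V, ∃ K : G.Subgraph, v ∈ K.verts ∧ Nonempty (K.coe ≃g H)

/-- `F` is an embedded vertex-cut of `G` with respect to the subnetwork `H`: `G - F` is
disconnected (it has two vertices not joined by a walk) and each of its vertices lies in a copy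
of `H` in `G - F`. -/
def IsEmbeddedVertexCut {W V : Type*} (H : SimpleGraph W) (G : SimpleGraph V)
    (F : Set V) : Prop :=
  ¬ (G.induce Fᶜ).Preconnected ∧ EveryVertexInCopy H (G.induce Fᶜ)

/-- `F` is an embedded edge-cut of `G` with respect to the subnetwork `H`: a set of edges such
that `G - F` is disconnected and each vertex lies in a copy of `H` in `G - F`. -/
def IsEmbeddedEdgeCut {W V : Type*} (H : SimpleGraph W) (G : SimpleGraph V)
    (F : Set (Sym2 V)) : Prop :=
  F ⊆ G.edgeSet ∧ ¬ (G.deleteEdges F).Preconnected ∧ EveryVertexInCopy H (G.deleteEdges F)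

/-- The least cardinality of an embedded vertex-cut (`⊤` if there is none). For `H = G_h` and
`G = G_n` in a family of networks this is the `h`-embedded connectivity of `G_n`. -/
noncomputable def embeddedConnectivity {W V : Type*} (H : SimpleGraph W)
    (G : SimpleGraph V) : ℕ∞ :=
  ⨅ (F : Set V) (_ : IsEmbeddedVertexCut H G F), F.encard

/-- The least cardinality of an embedded edge-cut (`⊤` if there is none). For `H = G_h` and
`G = G_n` in a family of networks this is the `h`-embedded edge-connectivity of `G_n`. -/
noncomputable def embeddedEdgeConnectivity {W V : Type*} (H : SimpleGraph W)
    (G : SimpleGraph V) : ℕ∞ :=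
  ⨅ (F : Set (Sym2 V)) (_ : IsEmbeddedEdgeCut H G F), F.encard

/-- The `h`-embedded connectivity `ζ_h(S_n)` of the star graph. -/
noncomputable def zetaStar (h n : ℕ) : ℕ∞ :=
  embeddedConnectivity (starGraph h) (starGraph n)

/-- The `h`-embedded edge-connectivity `η_h(S_n)` of the star graph. -/
noncomputable def etaStar (h n : ℕ) : ℕ∞ :=
  embeddedEdgeConnectivity (starGraph h) (starGraph n)

/-!
For the upper bounds, let `X` be the copy of `S_h` formed by the words with only the first `h`
positions permuted. It has `h !` vertices, each with `n - h` neighbours outside, so its edge boundary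
and its neighbourhood have at most `h ! * (n - h)` elements; both turn out to be embedded cuts
(`exists_isEmbeddedEdgeCut`, `exists_isEmbeddedVertexCut`).

The lower bounds use only that each vertex keeps at least `k = h - 1` neighbours on its own side. Both
kinds of cut are covered by mixed cuts: two disjoint nonempty sets `C`, `D` of minimum degree at
least `k`, whose cost is the number of remaining vertices plus the number of edges between them. That
the cost is at least `(k + 1)! * (m - (k + 1))` in dimension `m`
(`factorial_mul_sub_le_mixedCost`) is shown by induction on `k`. Fixing the digit at a position `t`
cuts the graph into `m` slices, which are star graphs of dimension `m - 1` where `C` and `D` have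
minimum degree at least `k - 1`. If `k + 1` slices meet both sides, their costs add up to the bound.
Otherwise either a whole slice is deleted, or some slices meet only `C` and others only `D` and the
matchings between them are expensive, or else one side meets all the slices and the other at most `k`.
If the last case holds for all `t`, then, since each side takes more than `k` digits at some position
(`exists_lt_card_digitsAt`), there are two positions at which opposite sides are thin; the words
avoiding both sides at these positions are deleted, and together with the cost inside the slices
meeting both sides they reach the bound. The case `k = 0`
runs the same way by induction on `m`, singletons being treated by hand.
-/

open Equiv Finset

/-! ### Cosets, digits and mixed cuts -/

section MixedCut

variable {α : Type*} [DecidableEq α]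

/-- The digits that the words of `C` have at position `t`. -/
def digitsAt (C : Finset (Perm α)) (t : α) : Finset α := C.image (fun v => v t)

theorem mem_digitsAt {C : Finset (Perm α)} {t i : α} :
    i ∈ digitsAt C t ↔ ∃ v ∈ C, v t = i := by
  simp [digitsAt]

theorem filter_nonempty_of_mem_digitsAt {C : Finset (Perm α)} {t i : α} (h : i ∈ digitsAt C t) :
    {v ∈ C | v t = i}.Nonempty := by
  obtain ⟨v, hv, hi⟩ := mem_digitsAt.1 h
  exact ⟨v, mem_filter.2 ⟨hv, hi⟩⟩

variable [Fintype α]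

/-- The words agreeing with `v₀` at every position outside `B`: a left coset of the symmetric group
on `B`. When `B` contains the first position, it induces a star graph of dimension `#B`; keeping
all these substars inside one type makes induction on the dimension free of isomorphisms. -/
def starCoset (B : Finset α) (v₀ : Perm α) : Finset (Perm α) :=
  {v | ∀ s, s ∉ B → v s = v₀ s}

/-- The cost of separating `C` from `D` inside `Q`, along the directions in `B` other than the base
position `z`: the number of vertices of `Q` in neither set plus the number of edges from `C` to `D`.
An edge from `v` in direction `s` is encoded as the pair `(v, s)`; its other end is
`v * swap z s`. Vertex-cuts and edge-cuts are the two extreme cases of such a mixed cut. -/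
def mixedCost (z : α) (B : Finset α) (Q C D : Finset (Perm α)) : ℕ :=
  #(Q \ (C ∪ D)) + #{e ∈ C ×ˢ B.erase z | e.1 * swap z e.2 ∈ D}

/-- Every word of `C` has at least `k` neighbours in `C` along the directions in `B` other than
`z`: minimum degree at least `k` in the subgraph induced by `C`. -/
def MinDirections (z : α) (B : Finset α) (k : ℕ) (C : Finset (Perm α)) : Prop :=
  ∀ v ∈ C, k ≤ #{s ∈ B.erase z | v * swap z s ∈ C}

theorem mem_starCoset {B : Finset α} {v₀ v : Perm α} :
    v ∈ starCoset B v₀ ↔ ∀ s, s ∉ B → v s = v₀ s := by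
  simp [starCoset]

theorem card_starCoset (B : Finset α) (v₀ : Perm α) : #(starCoset B v₀) = (#B)! := by
  have e : {v // v ∈ starCoset B v₀} ≃ {f : Perm α // ∀ a, ¬ a ∈ B → f a = a} :=
    { toFun := fun v => ⟨v₀⁻¹ * v.1, fun a ha => by
        rw [Perm.mul_apply, mem_starCoset.1 v.2 a ha,
          ← Perm.mul_apply, inv_mul_cancel, Perm.one_apply]⟩
      invFun := fun f => ⟨v₀ * f.1, mem_starCoset.2 fun a ha => by
        rw [Perm.mul_apply, f.2 a ha]⟩
      left_inv := fun v => by simp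
      right_inv := fun f => by simp }
  have h := Fintype.card_congr (e.trans (Perm.subtypeEquivSubtypePerm (· ∈ B)).symm)
  rw [Fintype.card_perm, Fintype.card_coe, Fintype.card_coe] at h
  exact h

theorem starCoset_filter_eq {B : Finset α} {v₀ v₁ : Perm α} (h : v₁ ∈ starCoset B v₀) (t : α) :
    {v ∈ starCoset B v₀ | v t = v₁ t} = starCoset (B.erase t) v₁ := by
  rw [mem_starCoset] at h
  ext v
  simp only [mem_filter, mem_starCoset, mem_erase, not_and]
  constructor
  · rintro ⟨h1, h2⟩ s hs
    by_cases hst : s = t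
    · rw [hst, h2]
    · rw [h1 s (hs hst), h s (hs hst)]
  · intro h1
    exact ⟨fun s hs => by rw [h1 s (fun _ => hs), h s hs], h1 t (fun h => absurd rfl h)⟩

theorem mul_swap_mem_starCoset {B : Finset α} {v₀ v : Perm α} (hv : v ∈ starCoset B v₀) {s t : α}
    (hs : s ∈ B) (ht : t ∈ B) : v * swap s t ∈ starCoset B v₀ := by
  rw [mem_starCoset] at hv ⊢
  intro r hr
  rw [Perm.mul_apply, swap_apply_of_ne_of_ne (by rintro rfl; exact hr hs)
    (by rintro rfl; exact hr ht), hv r hr]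

theorem image_eq_of_mem_starCoset {B : Finset α} {v₀ v : Perm α} (hv : v ∈ starCoset B v₀) :
    B.image v = B.image v₀ := by
  rw [mem_starCoset] at hv
  refine eq_of_subset_of_card_le (fun i hi => ?_) ?_
  · obtain ⟨s, hs, rfl⟩ := mem_image.1 hi
    refine mem_image.2 ⟨v₀.symm (v s), ?_, by simp⟩
    by_contra hr
    have h1 : v (v₀.symm (v s)) = v s := by rw [hv _ hr, apply_symm_apply]
    rw [v.injective h1] at hr
    exact hr hs
  · rw [card_image_of_injective _ v.injective, card_image_of_injective _ v₀.injective]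

theorem exists_mem_starCoset_apply_eq {B : Finset α} {v₀ v : Perm α} (hv : v ∈ starCoset B v₀)
    {t i : α} (ht : t ∈ B) (hi : i ∈ B.image v₀) :
    ∃ s, v * swap t s ∈ starCoset B v₀ ∧ (v * swap t s) t = i := by
  rw [← image_eq_of_mem_starCoset hv] at hi
  obtain ⟨s, hs, rfl⟩ := mem_image.1 hi
  exact ⟨s, mul_swap_mem_starCoset hv ht hs, by simp⟩

theorem self_mem_starCoset (B : Finset α) (v₀ : Perm α) : v₀ ∈ starCoset B v₀ :=
  mem_starCoset.2 fun _ _ => rfl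

theorem card_filter_apply_eq {B : Finset α} {v₀ : Perm α} {t i : α} (ht : t ∈ B)
    (hi : i ∈ B.image v₀) : #{v ∈ starCoset B v₀ | v t = i} = (#B - 1)! := by
  obtain ⟨s, h1, rfl⟩ := exists_mem_starCoset_apply_eq (self_mem_starCoset B v₀) ht hi
  rw [starCoset_filter_eq h1, card_starCoset, card_erase_of_mem ht]

theorem card_filter_apply_eq_apply_eq {B : Finset α} {v₀ : Perm α} {t t' i i' : α} (ht : t ∈ B)
    (ht' : t' ∈ B) (htt : t ≠ t') (hi : i ∈ B.image v₀) (hi' : i' ∈ B.image v₀) (hii : i ≠ i') :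
    #{v ∈ starCoset B v₀ | v t = i ∧ v t' = i'} = (#B - 2)! := by
  obtain ⟨s, h1, rfl⟩ := exists_mem_starCoset_apply_eq (self_mem_starCoset B v₀) ht hi
  rw [← filter_filter, starCoset_filter_eq h1]
  set v₁ := v₀ * swap t s
  rw [card_filter_apply_eq (mem_erase.2 ⟨htt.symm, ht'⟩), card_erase_of_mem ht, Nat.sub_sub]
  rw [← image_eq_of_mem_starCoset h1] at hi'
  obtain ⟨r, hr, rfl⟩ := mem_image.1 hi'
  exact mem_image_of_mem _ (mem_erase.2 ⟨fun h => hii (by rw [h]), hr⟩)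

/-- In a coset, each pair of distinct admissible digits at two given positions is taken equally
often. -/
theorem card_filter_pair_mem {B : Finset α} {v₀ : Perm α} {t t' : α} (ht : t ∈ B)
    (ht' : t' ∈ B) (htt : t ≠ t') {S : Finset (α × α)}
    (hS : ∀ p ∈ S, p.1 ∈ B.image v₀ ∧ p.2 ∈ B.image v₀ ∧ p.1 ≠ p.2) :
    #{v ∈ starCoset B v₀ | (v t, v t') ∈ S} = #S * (#B - 2)! := by
  rw [card_eq_sum_card_fiberwise (s := {v ∈ starCoset B v₀ | (v t, v t') ∈ S})
    (f := fun v : Perm α => (v t, v t')) (t := S) (fun v hv => (mem_filter.1 hv).2), sum_const_nat]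
  intro p hp
  obtain ⟨h1, h2, h3⟩ := hS p hp
  rw [← card_filter_apply_eq_apply_eq ht ht' htt h1 h2 h3, filter_filter]
  congr 1
  ext v
  simp only [mem_filter]
  refine and_congr_right fun _ => ⟨fun h => Prod.ext_iff.1 h.2, fun h => ?_⟩
  have : (v t, v t') = p := Prod.ext_iff.2 h
  exact ⟨this ▸ hp, this⟩

/-- Slicing along position `t`: the costs inside the slices with digit in `J`, the deleted vertices
outside these slices, and the cut edges in direction `t` are disjoint parts of the total cost. -/
theorem sum_mixedCost_le (z t : α) (ht : t ∈ B.erase z) (Q C D : Finset (Perm α))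
    (J : Finset α) :
    ∑ i ∈ J, mixedCost z (B.erase t) {v ∈ Q | v t = i} {v ∈ C | v t = i} {v ∈ D | v t = i} +
      #{v ∈ Q \ (C ∪ D) | v t ∉ J} + #{v ∈ C | v * swap z t ∈ D} ≤ mixedCost z B Q C D := by
  simp only [mixedCost, sum_add_distrib]
  set E := {e ∈ C ×ˢ B.erase z | e.1 * swap z e.2 ∈ D} with hE
  have h1 : ∑ i ∈ J, #({v ∈ Q | v t = i} \ ({v ∈ C | v t = i} ∪ {v ∈ D | v t = i})) =
      #{v ∈ Q \ (C ∪ D) | v t ∈ J} := by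
    rw [card_eq_sum_card_fiberwise (s := {v ∈ Q \ (C ∪ D) | v t ∈ J})
      (f := fun v : Perm α => v t) (t := J) (fun v hv => (mem_filter.1 hv).2)]
    refine sum_congr rfl fun i hi => ?_
    congr 1
    ext v
    simp only [mem_filter, mem_sdiff, mem_union]
    constructor
    · rintro ⟨⟨h1, rfl⟩, h2⟩
      simp_all
    · rintro ⟨⟨⟨h1, h2⟩, h3⟩, rfl⟩
      simp_all
  have h2 : ∑ i ∈ J, #{e ∈ {v ∈ C | v t = i} ×ˢ (B.erase t).erase z |
      e.1 * swap z e.2 ∈ {v ∈ D | v t = i}} ≤ #{e ∈ E | e.2 ≠ t} := by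
    have h3 : ∑ i ∈ J, #{e ∈ {e ∈ E | e.2 ≠ t ∧ e.1 t ∈ J} | e.1 t = i} ≤ #{e ∈ E | e.2 ≠ t} := by
      rw [← card_eq_sum_card_fiberwise (f := fun e : Perm α × α => e.1 t) (t := J)
        (fun v hv => (mem_filter.1 hv).2.2)]
      exact card_le_card fun e he => by simp_all
    refine le_trans (sum_le_sum fun i hi => card_le_card fun e he => ?_) h3
    simp only [hE, mem_filter, mem_product, mem_erase] at he ⊢
    obtain ⟨⟨⟨h1, h2⟩, h3, h4, h5⟩, h6, h7⟩ := he
    exact ⟨⟨⟨⟨h1, h3, h5⟩, h6⟩, h4, h2 ▸ hi⟩, h2⟩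
  have h3 : #{v ∈ C | v * swap z t ∈ D} ≤ #{e ∈ E | ¬ e.2 ≠ t} := by
    refine card_le_card_of_injOn (fun v => (v, t)) (fun v hv => ?_)
      (fun v _ w _ h => (Prod.ext_iff.1 h).1)
    simp only [hE, coe_filter, mem_filter, mem_product, Set.mem_ofPred_eq, not_not, and_true] at hv ⊢
    exact ⟨⟨hv.1, ht⟩, hv.2⟩
  have h4 := card_filter_add_card_filter_not (s := E) (fun e => e.2 ≠ t)
  have h5 := card_filter_add_card_filter_not (s := Q \ (C ∪ D)) (fun v => v t ∈ J)
  omega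

theorem digitsAt_subset {B : Finset α} {v₀ : Perm α} {C : Finset (Perm α)}
    (hC : C ⊆ starCoset B v₀) {t : α} (ht : t ∈ B) : digitsAt C t ⊆ B.image v₀ := by
  intro i hi
  obtain ⟨v, hv, rfl⟩ := mem_digitsAt.1 hi
  rw [← image_eq_of_mem_starCoset (hC hv)]
  exact mem_image_of_mem _ ht

/-! ### The induction step -/

/-- If the slices with digit in `A` at `t` miss `D` and those with digit in `A'` miss `C`, every
edge in direction `t` between the two families has a deleted end or is cut. These edges form a
matching, and there are `#A * #A' * (#B - 2)!` of them. -/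
theorem card_mul_card_mul_factorial_le {z : α} {B : Finset α} {v₀ : Perm α}
    {C D : Finset (Perm α)} {t : α} (hz : z ∈ B) (ht : t ∈ B.erase z) {A A' J : Finset α}
    (hA : A ⊆ B.image v₀) (hA' : A' ⊆ B.image v₀) (hAA : Disjoint A A')
    (hAJ : Disjoint A J) (hAJ' : Disjoint A' J)
    (hAD : Disjoint A (digitsAt D t)) (hAC : Disjoint A' (digitsAt C t)) :
    #A * #A' * (#B - 2)! ≤
      #{v ∈ starCoset B v₀ \ (C ∪ D) | v t ∉ J} + #{v ∈ C | v * swap z t ∈ D} := by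
  obtain ⟨htz, htB⟩ := mem_erase.1 ht
  set F := starCoset B v₀ \ (C ∪ D) with hF
  have h1 := card_filter_pair_mem (v₀ := v₀) htB hz htz (S := A ×ˢ A') fun p hp => by
    rw [mem_product] at hp
    exact ⟨hA hp.1, hA' hp.2, fun h => disjoint_left.1 hAA hp.1 (h ▸ hp.2)⟩
  rw [card_product] at h1
  rw [← h1]
  have h2 : {v ∈ starCoset B v₀ | (v t, v z) ∈ A ×ˢ A'} ⊆
      ({v ∈ F | v t ∈ A} ∪ {v ∈ F | v t ∈ A'}.image (· * swap z t)) ∪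
        {v ∈ C | v * swap z t ∈ D} := by
    intro v hv
    rw [mem_filter, mem_product] at hv
    obtain ⟨hvQ, hvA, hvA'⟩ := hv
    have hvt : (v * swap z t) t = v z := by simp
    have hvD : v ∉ D := fun h => disjoint_left.1 hAD hvA (mem_digitsAt.2 ⟨v, h, rfl⟩)
    have hwC : v * swap z t ∉ C :=
      fun h => disjoint_left.1 hAC hvA' (mem_digitsAt.2 ⟨_, h, hvt⟩)
    have hwQ := mul_swap_mem_starCoset hvQ hz htB
    by_cases hvC : v ∈ C
    · by_cases hwD : v * swap z t ∈ D
      · exact mem_union_right _ (mem_filter.2 ⟨hvC, hwD⟩)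
      · refine mem_union_left _ (mem_union_right _ (mem_image.2 ⟨v * swap z t,
          mem_filter.2 ⟨mem_sdiff.2 ⟨hwQ, ?_⟩, by rwa [hvt]⟩, by simp [mul_assoc]⟩))
        simp [hwC, hwD]
    · refine mem_union_left _ (mem_union_left _ (mem_filter.2 ⟨mem_sdiff.2 ⟨hvQ, ?_⟩, hvA⟩))
      simp [hvC, hvD]
  refine (card_le_card h2).trans ((card_union_le _ _).trans (Nat.add_le_add_right ?_ _))
  refine (card_union_le _ _).trans ((Nat.add_le_add_left card_image_le _).trans ?_)
  rw [← card_union_of_disjoint]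
  · refine card_le_card fun v hv => ?_
    rcases mem_union.1 hv with hv | hv <;> rw [mem_filter] at hv ⊢
    · exact ⟨hv.1, disjoint_left.1 hAJ hv.2⟩
    · exact ⟨hv.1, disjoint_left.1 hAJ' hv.2⟩
  · refine disjoint_left.2 fun v hv hv' => ?_
    exact disjoint_left.1 hAA (mem_filter.1 hv).2 (mem_filter.1 hv').2

/-- A word whose digit at `t` lies in `I` is not in `C` and one whose digit at `t'` lies in `I'` is
not in `D`, so the words satisfying both are all deleted. -/
theorem card_mul_card_sub_one_mul_factorial_le {B : Finset α} {v₀ : Perm α}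
    {C D : Finset (Perm α)} {t t' : α} (ht : t ∈ B) (ht' : t' ∈ B) (htt : t ≠ t')
    {I I' J : Finset α} (hI : I ⊆ B.image v₀) (hI' : I' ⊆ B.image v₀) (hIJ : Disjoint I J)
    (hIC : Disjoint I (digitsAt C t)) (hID : Disjoint I' (digitsAt D t')) :
    #I * (#I' - 1) * (#B - 2)! ≤ #{v ∈ starCoset B v₀ \ (C ∪ D) | v t ∉ J} := by
  have h1 := card_filter_pair_mem (v₀ := v₀) ht ht' htt (S := {p ∈ I ×ˢ I' | p.1 ≠ p.2})
    fun p hp => by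
      rw [mem_filter, mem_product] at hp
      exact ⟨hI hp.1.1, hI' hp.1.2, hp.2⟩
  have h2 : #I * (#I' - 1) ≤ #{p ∈ I ×ˢ I' | p.1 ≠ p.2} := by
    have h3 := card_filter_add_card_filter_not (s := I ×ˢ I') (fun p => p.1 ≠ p.2)
    have h4 : #{p ∈ I ×ˢ I' | ¬ p.1 ≠ p.2} ≤ #I := by
      refine card_le_card_of_injOn Prod.fst (fun p hp => ?_) fun p hp q hq h => ?_
      · exact (mem_product.1 (mem_filter.1 hp).1).1
      · have hp' := not_not.1 (mem_filter.1 hp).2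
        have hq' := not_not.1 (mem_filter.1 hq).2
        exact Prod.ext h (by rw [← hp', ← hq', h])
    rw [card_product] at h3
    rw [Nat.mul_sub, mul_one]
    omega
  refine (Nat.mul_le_mul_right _ h2).trans (h1.symm.le.trans (card_le_card fun v hv => ?_))
  rw [mem_filter, mem_filter, mem_product] at hv
  obtain ⟨hvQ, ⟨hvI, hvI'⟩, -⟩ := hv
  rw [mem_filter, mem_sdiff, mem_union, not_or]
  exact ⟨⟨hvQ, fun h => disjoint_left.1 hIC hvI (mem_digitsAt.2 ⟨v, h, rfl⟩),
    fun h => disjoint_left.1 hID hvI' (mem_digitsAt.2 ⟨v, h, rfl⟩)⟩, disjoint_left.1 hIJ hvI⟩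

/-- The induction step in numerical form. Here `L` bounds the cost of each slice meeting both sides,
and each side is assumed to take more than `c` digits at some position. If the cost were below `T`,
then by `hT₁`–`hT₃`, at each position one side takes every digit and the other at most `c`. By
`hCt` and `hDt` both alternatives occur, at distinct positions, and then `hT₄` applies. -/
theorem le_mixedCost_of_slices {z : α} {B : Finset α} {v₀ : Perm α} {C D : Finset (Perm α)}
    (hz : z ∈ B) (hC : C ⊆ starCoset B v₀) (hD : D ⊆ starCoset B v₀) {c L T : ℕ}
    (hL : ∀ t ∈ B.erase z, ∀ i ∈ digitsAt C t ∩ digitsAt D t,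
      L ≤ mixedCost z (B.erase t) {v ∈ starCoset B v₀ | v t = i} {v ∈ C | v t = i}
        {v ∈ D | v t = i})
    (hCt : ∃ t ∈ B.erase z, c < #(digitsAt C t)) (hDt : ∃ t ∈ B.erase z, c < #(digitsAt D t))
    (hT₁ : T ≤ (c + 1) * L) (hT₂ : T ≤ (#B - 1)!)
    (hT₃ : ∀ a b j, 0 < a → 0 < b → j ≤ c → a + b + j = #B → T ≤ j * L + a * b * (#B - 2)!)
    (hT₄ : ∀ x y, #B - c ≤ x → x ≤ #B → #B - c ≤ y →
      T ≤ (#B - x) * L + x * (y - 1) * (#B - 2)!) :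
    T ≤ mixedCost z B (starCoset B v₀) C D := by
  by_contra! hlt
  set W := B.image v₀ with hW
  have hWcard : #W = #B := card_image_of_injective _ v₀.injective
  have hslice : ∀ t ∈ B.erase z, #(digitsAt C t ∩ digitsAt D t) * L +
      #{v ∈ starCoset B v₀ \ (C ∪ D) | v t ∉ digitsAt C t ∩ digitsAt D t} +
      #{v ∈ C | v * swap z t ∈ D} ≤ mixedCost z B (starCoset B v₀) C D := by
    intro t ht
    refine le_trans ?_ (sum_mixedCost_le z t ht _ C D (digitsAt C t ∩ digitsAt D t))
    have := card_nsmul_le_sum _ _ _ (hL t ht)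
    rw [smul_eq_mul] at this
    omega
  -- At each position, one side takes all digits and the other only few.
  have key : ∀ t ∈ B.erase z, (digitsAt D t = W ∧ #(digitsAt C t) ≤ c) ∨
      (digitsAt C t = W ∧ #(digitsAt D t) ≤ c) := by
    intro t ht
    have htB := mem_of_mem_erase ht
    have hs := hslice t ht
    have hCW : digitsAt C t ⊆ W := digitsAt_subset hC htB
    have hDW : digitsAt D t ⊆ W := digitsAt_subset hD htB
    have hj : #(digitsAt C t ∩ digitsAt D t) ≤ c := by
      by_contra! hj
      have := Nat.mul_le_mul_right L (Nat.succ_le_of_lt hj)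
      rw [Nat.succ_eq_add_one] at this
      omega
    -- A slice missing both sides would be deleted altogether.
    have hU : digitsAt C t ∪ digitsAt D t = W := by
      refine subset_antisymm (union_subset hCW hDW) fun i hi => ?_
      by_contra hiU
      rw [mem_union, not_or] at hiU
      have h1 : #{v ∈ starCoset B v₀ | v t = i} ≤
          #{v ∈ starCoset B v₀ \ (C ∪ D) | v t ∉ digitsAt C t ∩ digitsAt D t} := by
        refine card_le_card fun v hv => ?_
        obtain ⟨hvQ, rfl⟩ := mem_filter.1 hv
        rw [mem_filter, mem_sdiff, mem_union, not_or]
        exact ⟨⟨hvQ, fun h => hiU.1 (mem_digitsAt.2 ⟨v, h, rfl⟩),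
          fun h => hiU.2 (mem_digitsAt.2 ⟨v, h, rfl⟩)⟩, fun h => hiU.1 (mem_inter.1 h).1⟩
      rw [card_filter_apply_eq htB hi] at h1
      omega
    by_cases ha : W \ digitsAt D t = ∅
    · left
      have h1 := subset_antisymm hDW (sdiff_eq_empty_iff_subset.1 ha)
      rw [h1, inter_eq_left.2 hCW] at hj
      exact ⟨h1, hj⟩
    by_cases hb : W \ digitsAt C t = ∅
    · right
      have h1 := subset_antisymm hCW (sdiff_eq_empty_iff_subset.1 hb)
      rw [h1, inter_eq_right.2 hDW] at hj
      exact ⟨h1, hj⟩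
    exfalso
    have h1 := card_mul_card_mul_factorial_le (C := C) (D := D) (v₀ := v₀) hz ht
      (A := W \ digitsAt D t)
      (A' := W \ digitsAt C t) (J := digitsAt C t ∩ digitsAt D t) sdiff_subset sdiff_subset
      (by
        rw [disjoint_left]
        intro i h1 h2
        rw [mem_sdiff] at h1 h2
        rcases mem_union.1 (hU ▸ h1.1) with h | h
        exacts [h2.2 h, h1.2 h])
      (sdiff_disjoint.mono_right inter_subset_right) (sdiff_disjoint.mono_right inter_subset_left)
      sdiff_disjoint sdiff_disjoint
    have h2 := hT₃ #(W \ digitsAt D t) #(W \ digitsAt C t) #(digitsAt C t ∩ digitsAt D t)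
      (card_pos.2 (nonempty_iff_ne_empty.2 ha)) (card_pos.2 (nonempty_iff_ne_empty.2 hb)) hj (by
        have e1 := card_sdiff_of_subset hDW
        have e2 := card_sdiff_of_subset hCW
        have e3 := card_union_add_card_inter (digitsAt C t) (digitsAt D t)
        rw [hU] at e3
        have e4 := card_le_card hDW
        have e5 := card_le_card hCW
        omega)
    omega
  obtain ⟨t', ht', hCt'⟩ := hCt
  obtain ⟨t, ht, hDt'⟩ := hDt
  have k1 := (key t ht).resolve_right fun h => by omega
  have k2 := (key t' ht').resolve_left fun h => by omega
  have htt : t ≠ t' := by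
    rintro rfl
    omega
  have hCW : digitsAt C t ⊆ W := digitsAt_subset hC (mem_of_mem_erase ht)
  have hDW : digitsAt D t' ⊆ W := digitsAt_subset hD (mem_of_mem_erase ht')
  have hs := hslice t ht
  rw [k1.1, inter_eq_left.2 hCW] at hs
  have h1 := card_mul_card_sub_one_mul_factorial_le (C := C) (D := D) (v₀ := v₀)
    (mem_of_mem_erase ht) (mem_of_mem_erase ht') htt (I := W \ digitsAt C t)
    (I' := W \ digitsAt D t') (J := digitsAt C t) sdiff_subset sdiff_subset
    sdiff_disjoint sdiff_disjoint sdiff_disjoint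
  have e1 := card_sdiff_of_subset hCW
  have e2 := card_sdiff_of_subset hDW
  have e3 := card_le_card hCW
  have h2 := hT₄ #(W \ digitsAt C t) #(W \ digitsAt D t') (by omega) (by omega) (by omega)
  have e4 : #B - #(W \ digitsAt C t) = #(digitsAt C t) := by omega
  rw [e4] at h2
  omega

/-! ### Degree conditions and the lower bound for mixed cuts -/

/-- A set of minimum degree at least `k > 0` takes at least `k + 1` digits at some position.
In a connected part `K` of it, let `X` be the set of digits that come first in some word and `T`
the set of directions used. Each `x ∈ X` moves from the first position to at least `k` positions
of `T`, and `#T < #X` because the digits of a word `v₀` of `K` at the first position and at those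
in `T` all lie in `X`; double counting gives a position of `T` with more than `k` digits. -/
theorem exists_lt_card_digitsAt {z : α} {B : Finset α} {k : ℕ} (hk : 0 < k)
    {C : Finset (Perm α)} (hne : C.Nonempty) (hdeg : MinDirections z B k C) :
    ∃ t ∈ B.erase z, k < #(digitsAt C t) := by
  classical
  obtain ⟨v₀, hv₀⟩ := hne
  let r : Perm α → Perm α → Prop := fun u w => w ∈ C ∧ ∃ s ∈ B.erase z, w = u * swap z s
  let K : Finset (Perm α) := {v ∈ C | Relation.ReflTransGen r v₀ v}
  have hK₀ : v₀ ∈ K := mem_filter.2 ⟨hv₀, .refl⟩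
  have hKstep : ∀ v ∈ K, ∀ s ∈ B.erase z, v * swap z s ∈ C → v * swap z s ∈ K :=
    fun v hv s hs h => mem_filter.2 ⟨h, (mem_filter.1 hv).2.tail ⟨h, s, hs, rfl⟩⟩
  let X := digitsAt K z
  let T : Finset α := {s ∈ B.erase z | ∃ v ∈ K, v * swap z s ∈ K}
  have hTX : #T + 1 ≤ #X := by
    have hzT : z ∉ T := fun h => (mem_erase.1 (mem_filter.1 h).1).1 rfl
    rw [← card_insert_of_notMem hzT, ← card_image_of_injective _ v₀.injective]
    refine card_le_card fun x hx => ?_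
    obtain ⟨t, ht, rfl⟩ := mem_image.1 hx
    rcases mem_insert.1 ht with rfl | ht
    · exact mem_digitsAt.2 ⟨v₀, hK₀, rfl⟩
    by_contra hX
    obtain ⟨htB, u, hu, hu'⟩ := mem_filter.1 ht
    have htz : t ≠ z := (mem_erase.1 htB).1
    -- A digit that never comes first never moves, so direction `t` could not be used.
    have hfix : ∀ w, Relation.ReflTransGen r v₀ w → w t = v₀ t := by
      intro w hw
      induction hw with
      | refl => rfl
      | @tail a b hab hb ih =>
        obtain ⟨hbC, s, hs, rfl⟩ := hb
        rcases eq_or_ne t s with rfl | hts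
        · refine absurd (mem_digitsAt.2 ⟨a * swap z t, ?_, ?_⟩) hX
          · exact mem_filter.2 ⟨hbC, hab.tail ⟨hbC, t, hs, rfl⟩⟩
          · simpa using ih
        · rw [Perm.mul_apply, swap_apply_of_ne_of_ne htz hts, ih]
    have h1 := hfix u (mem_filter.1 hu).2
    have h2 := hfix _ (mem_filter.1 hu').2
    rw [Perm.mul_apply, swap_apply_right, ← h1] at h2
    exact htz (u.injective h2).symm
  have hXT : ∀ x ∈ X, k ≤ #{t ∈ T | x ∈ digitsAt K t} := by
    intro x hx
    obtain ⟨v, hv, rfl⟩ := mem_digitsAt.1 hx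
    refine (hdeg v (mem_filter.1 hv).1).trans (card_le_card fun s hs => ?_)
    obtain ⟨hsB, hs⟩ := mem_filter.1 hs
    have h1 := hKstep v hv s hsB hs
    exact mem_filter.2 ⟨mem_filter.2 ⟨hsB, v, hv, h1⟩, mem_digitsAt.2 ⟨_, h1, by simp⟩⟩
  by_contra! hcon
  have h1 : #X * k ≤ ∑ x ∈ X, #{t ∈ T | x ∈ digitsAt K t} := by
    simpa using card_nsmul_le_sum _ _ _ hXT
  have h2 : ∑ x ∈ X, #{t ∈ T | x ∈ digitsAt K t} = ∑ t ∈ T, #{x ∈ X | x ∈ digitsAt K t} :=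
    sum_card_bipartiteAbove_eq_sum_card_bipartiteBelow (fun x t => x ∈ digitsAt K t)
  have h3 : ∑ t ∈ T, #{x ∈ X | x ∈ digitsAt K t} ≤ #T * k := by
    rw [← smul_eq_mul]
    refine sum_le_card_nsmul _ _ _ fun t ht => (card_le_card (t := digitsAt C t) ?_).trans
      (hcon t (mem_filter.1 ht).1)
    intro x hx
    obtain ⟨v, hv, rfl⟩ := mem_digitsAt.1 (mem_filter.1 hx).2
    exact mem_digitsAt.2 ⟨v, (mem_filter.1 hv).1, rfl⟩
  have h4 := Nat.mul_le_mul_right k hTX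
  rw [add_mul] at h4
  omega

theorem exists_one_lt_card_digitsAt {z : α} {B : Finset α} {v₀ : Perm α} {C : Finset (Perm α)}
    (hC : C ⊆ starCoset B v₀) (h1 : 1 < #C) : ∃ t ∈ B.erase z, 1 < #(digitsAt C t) := by
  obtain ⟨u, hu, w, hw, huw⟩ := one_lt_card.1 h1
  have h2 : ∃ t, t ≠ z ∧ u t ≠ w t := by
    by_contra! h
    refine huw (Equiv.ext fun s => ?_)
    by_cases hs : s = z
    · subst hs
      -- The digits away from `s` determine the digit at `s`.
      obtain ⟨r, hr⟩ := w.surjective (u s)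
      by_cases hrs : r = s
      · rw [← hr, hrs]
      · exact absurd (u.injective ((h r hrs).trans hr)) hrs
    · exact h s hs
  obtain ⟨t, htz, ht⟩ := h2
  refine ⟨t, mem_erase.2 ⟨htz, ?_⟩, one_lt_card.2
    ⟨_, mem_digitsAt.2 ⟨u, hu, rfl⟩, _, mem_digitsAt.2 ⟨w, hw, rfl⟩, ht⟩⟩
  by_contra htB
  exact ht (by rw [mem_starCoset.1 (hC hu) t htB, mem_starCoset.1 (hC hw) t htB])

theorem mixedCost_comm (z : α) (B : Finset α) (Q C D : Finset (Perm α)) :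
    mixedCost z B Q C D = mixedCost z B Q D C := by
  have h : ∀ C D : Finset (Perm α), #{e ∈ C ×ˢ B.erase z | e.1 * swap z e.2 ∈ D} ≤
      #{e ∈ D ×ˢ B.erase z | e.1 * swap z e.2 ∈ C} := fun C D => by
    refine card_le_card_of_injOn (fun e => (e.1 * swap z e.2, e.2)) (fun e he => ?_)
      fun e _ f _ hef => ?_
    · simp only [coe_filter, mem_product, Set.mem_ofPred_eq] at he ⊢
      exact ⟨⟨he.2, he.1.2⟩, by simpa [mul_assoc] using he.1.1⟩
    · obtain ⟨h1, h2⟩ := Prod.ext_iff.1 hef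
      simp only at h1 h2
      rw [h2] at h1
      exact Prod.ext (mul_right_cancel h1) h2
  rw [mixedCost, mixedCost, union_comm, (h C D).antisymm (h D C)]

theorem card_sub_one_le_mixedCost_singleton {z : α} {B : Finset α} {v₀ v : Perm α}
    {D : Finset (Perm α)} (hz : z ∈ B) (hv : v ∈ starCoset B v₀) :
    #B - 1 ≤ mixedCost z B (starCoset B v₀) {v} D := by
  rw [← card_erase_of_mem hz,
    ← card_filter_add_card_filter_not (s := B.erase z) (fun s => v * swap z s ∉ D), mixedCost]
  refine add_le_add ?_ ?_
  · refine card_le_card_of_injOn (fun s => v * swap z s) (fun s hs => ?_) fun s hs s' hs' h => ?_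
    · obtain ⟨hsB, hsD⟩ := mem_filter.1 hs
      obtain ⟨hsz, hsB⟩ := mem_erase.1 hsB
      refine mem_sdiff.2 ⟨mul_swap_mem_starCoset hv hz hsB, ?_⟩
      rw [mem_union, mem_singleton, mul_eq_left, swap_eq_one_iff]
      exact fun h => h.elim (fun h => hsz h.symm) hsD
    · simpa using congrArg (fun w : Perm α => w z) h
  · refine card_le_card_of_injOn (fun s => (v, s)) (fun s hs => ?_)
      fun s hs s' hs' h => (Prod.ext_iff.1 h).2
    obtain ⟨hsB, hsD⟩ := mem_filter.1 hs
    exact mem_filter.2 ⟨mem_product.2 ⟨mem_singleton_self v, hsB⟩, not_not.1 hsD⟩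

/-- Passing to a slice loses one direction, hence at most one neighbour of each word. -/
theorem MinDirections.slice {z : α} {B : Finset α} {k : ℕ} {C : Finset (Perm α)}
    (h : MinDirections z B (k + 1) C) {t : α} (ht : t ∈ B.erase z) (i : α) :
    MinDirections z (B.erase t) k {v ∈ C | v t = i} := by
  intro v hv
  obtain ⟨hvC, hvi⟩ := mem_filter.1 hv
  have h1 := h v hvC
  have h2 : {s ∈ B.erase z | v * swap z s ∈ C} ⊆
      insert t {s ∈ (B.erase t).erase z | v * swap z s ∈ {v ∈ C | v t = i}} := by
    intro s hs
    simp only [mem_filter, mem_insert, mem_erase] at hs ⊢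
    by_cases hst : s = t
    · exact Or.inl hst
    · refine Or.inr ⟨⟨hs.1.1, hst, hs.1.2⟩, hs.2, ?_⟩
      rw [Perm.mul_apply, swap_apply_of_ne_of_ne (mem_erase.1 ht).1 (Ne.symm hst), hvi]
  have h3 := (card_le_card h2).trans (card_insert_le _ _)
  omega

/-- Mixed connectivity of the star graph: without a degree condition, the cost of separating two
nonempty sets is at least the degree. -/
theorem card_sub_one_le_mixedCost {z : α} (m : ℕ) : ∀ {B : Finset α} {v₀ : Perm α}
    {C D : Finset (Perm α)}, #B = m → z ∈ B → C ⊆ starCoset B v₀ → D ⊆ starCoset B v₀ →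
    Disjoint C D → C.Nonempty → D.Nonempty →
    m - 1 ≤ mixedCost z B (starCoset B v₀) C D := by
  induction m with
  | zero => simp
  | succ m ih =>
  intro B v₀ C D hB hz hC hD hCD hCn hDn
  -- A singleton is separated by its own incidences; a larger set takes two digits somewhere, which
  -- is what the induction step needs.
  rcases (Nat.succ_le_of_lt hCn.card_pos).eq_or_lt' with h1 | hC1
  · obtain ⟨v, rfl⟩ := card_eq_one.1 h1
    rw [← hB]
    exact card_sub_one_le_mixedCost_singleton hz (hC (mem_singleton_self v))
  rcases (Nat.succ_le_of_lt hDn.card_pos).eq_or_lt' with h1 | hD1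
  · obtain ⟨v, rfl⟩ := card_eq_one.1 h1
    rw [← hB, mixedCost_comm]
    exact card_sub_one_le_mixedCost_singleton hz (hD (mem_singleton_self v))
  have hm : 2 ≤ m := by
    by_contra! hm
    have h1 := card_le_card (union_subset hC hD)
    rw [card_union_of_disjoint hCD, card_starCoset, hB] at h1
    have : (m + 1)! ≤ 2 ! := Nat.factorial_le (by omega)
    have : 2 ! = 2 := rfl
    omega
  refine le_mixedCost_of_slices (c := 1) (L := m - 1) hz hC hD ?_
    (exists_one_lt_card_digitsAt hC hC1) (exists_one_lt_card_digitsAt hD hD1) ?_ ?_ ?_ ?_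
  · intro t ht i hi
    obtain ⟨h1, h2⟩ := mem_inter.1 hi
    obtain ⟨v, hv, rfl⟩ := mem_digitsAt.1 h1
    have h3 := starCoset_filter_eq (hC hv) t
    rw [h3]
    exact ih (by rw [card_erase_of_mem (mem_of_mem_erase ht), hB, Nat.add_sub_cancel])
      (mem_erase.2 ⟨(mem_erase.1 ht).1.symm, hz⟩) (h3 ▸ filter_subset_filter _ hC)
      (h3 ▸ filter_subset_filter _ hD) (disjoint_filter_filter hCD)
      (filter_nonempty_of_mem_digitsAt h1) (filter_nonempty_of_mem_digitsAt h2)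
  · omega
  · rw [hB]
    exact Nat.self_le_factorial _
  · intro a b j ha hb hj habj
    have h1 := Nat.factorial_pos (#B - 2)
    have h2 : a * b * 1 ≤ a * b * (#B - 2)! := Nat.mul_le_mul_left _ h1
    have h3 : a + b ≤ a * b + 1 := by
      obtain ⟨a, rfl⟩ := Nat.exists_eq_add_of_lt ha
      obtain ⟨b, rfl⟩ := Nat.exists_eq_add_of_lt hb
      ring_nf
      omega
    interval_cases j <;> omega
  · intro x y hx hx' hy
    have h1 := Nat.factorial_pos (#B - 2)
    have h2 : x * (y - 1) * 1 ≤ x * (y - 1) * (#B - 2)! := Nat.mul_le_mul_left _ h1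
    have h3 : m * 1 ≤ x * (y - 1) := Nat.mul_le_mul (by omega) (by omega)
    omega

/-- The lower bound for mixed cuts whose two sides have minimum degree at least `k`. It is
vacuous for `#B ≤ k + 1`, where the subtraction truncates. -/
theorem factorial_mul_sub_le_mixedCost {z : α} (k : ℕ) : ∀ {B : Finset α} {v₀ : Perm α}
    {C D : Finset (Perm α)}, z ∈ B → C ⊆ starCoset B v₀ → D ⊆ starCoset B v₀ →
    Disjoint C D → C.Nonempty → D.Nonempty → MinDirections z B k C → MinDirections z B k D →
    (k + 1)! * (#B - (k + 1)) ≤ mixedCost z B (starCoset B v₀) C D := by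
  induction k with
  | zero =>
    intro B v₀ C D hz hC hD hCD hCn hDn _ _
    simpa using card_sub_one_le_mixedCost #B rfl hz hC hD hCD hCn hDn
  | succ k ih =>
  intro B v₀ C D hz hC hD hCD hCn hDn hCk hDk
  rcases le_or_gt #B (k + 1 + 1) with hB | hB
  · simp [Nat.sub_eq_zero_of_le hB]
  -- With `#B = k + d + 3` the truncated subtractions become sums.
  obtain ⟨d, hd⟩ : ∃ d, #B = k + d + 3 := ⟨#B - (k + 3), by omega⟩
  have hd1 : #B - (k + 1 + 1) = d + 1 := by omega
  have hd2 : #B - 2 = k + d + 1 := by omega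
  have hd3 : #B - 1 = k + d + 2 := by omega
  have hfac : (k + 1 + 1)! = (k + 2) * (k + 1)! := Nat.factorial_succ _
  have hpos := Nat.factorial_pos (k + 1)
  have hmono : (k + 1)! ≤ (k + d + 1)! := Nat.factorial_le (by omega)
  rw [hd1]
  refine le_mixedCost_of_slices (c := k + 1) (L := (k + 1)! * (d + 1)) hz hC hD ?_
    (exists_lt_card_digitsAt k.succ_pos hCn hCk) (exists_lt_card_digitsAt k.succ_pos hDn hDk)
    ?_ ?_ ?_ ?_
  · intro t ht i hi
    obtain ⟨h1, h2⟩ := mem_inter.1 hi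
    obtain ⟨v, hv, hvi⟩ := mem_digitsAt.1 h1
    have h3 := starCoset_filter_eq (hC hv) t
    rw [hvi] at h3
    have h4 := ih (v₀ := v) (mem_erase.2 ⟨(mem_erase.1 ht).1.symm, hz⟩)
      (h3 ▸ filter_subset_filter _ hC)
      (h3 ▸ filter_subset_filter _ hD) (disjoint_filter_filter hCD)
      (filter_nonempty_of_mem_digitsAt h1) (filter_nonempty_of_mem_digitsAt h2)
      (hCk.slice ht i) (hDk.slice ht i)
    rw [card_erase_of_mem (mem_of_mem_erase ht), hd3] at h4
    rw [h3]
    convert h4 using 2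
    omega
  · rw [hfac, mul_assoc]
  · rw [hd3]
    rcases Nat.eq_zero_or_pos d with rfl | hd0
    · simp
    · have h1 : (k + d + 2)! = (k + d + 2) * (k + d + 1)! := Nat.factorial_succ _
      have h2 : (k + 2)! ≤ (k + d + 1)! := Nat.factorial_le (by omega)
      rw [h1, mul_comm]
      exact Nat.mul_le_mul (by omega) h2
  · intro a b j ha hb hj habj
    have h3 : a + b ≤ a * b + 1 := by
      obtain ⟨a, rfl⟩ := Nat.exists_eq_add_of_lt ha
      obtain ⟨b, rfl⟩ := Nat.exists_eq_add_of_lt hb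
      ring_nf
      omega
    rw [hd2]
    rcases Nat.eq_zero_or_pos d with rfl | hd0
    · have h4 : (k + 2) * (k + 1)! ≤ (j + a * b) * (k + 1)! := Nat.mul_le_mul_right _ (by omega)
      rw [hfac]
      simp only [add_zero, zero_add, mul_one]
      rwa [add_mul j] at h4
    · have h2 : (k + 2)! ≤ (k + d + 1)! := Nat.factorial_le (by omega)
      refine le_trans ?_ (Nat.le_add_left _ _)
      rw [mul_comm]
      exact Nat.mul_le_mul (by omega) h2
  · intro x y hx hx' hy
    rw [hd2]
    have h1 : x * (d + 1) * (k + 1)! ≤ x * (y - 1) * (k + d + 1)! :=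
      Nat.mul_le_mul (Nat.mul_le_mul_left _ (by omega)) hmono
    refine le_trans ?_ (Nat.add_le_add_left h1 _)
    have h2 : (#B - x) * ((k + 1)! * (d + 1)) + x * (d + 1) * (k + 1)! =
        #B * ((k + 1)! * (d + 1)) := by
      rw [show x * (d + 1) * (k + 1)! = x * ((k + 1)! * (d + 1)) by ring, ← add_mul,
        Nat.sub_add_cancel hx']
    rw [h2, hfac, mul_assoc]
    exact Nat.mul_le_mul_right _ (by omega)

end MixedCut

/-! ### Lower bounds for embedded cuts -/

theorem starGraph_adj {N : ℕ} {p q : Perm (Fin (N + 1))} :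
    (starGraph (N + 1)).Adj p q ↔ ∃ s, s ≠ 0 ∧ q = p * swap 0 s := by
  constructor
  · rintro ⟨i, j, hi, hj, rfl⟩
    obtain rfl : i = 0 := Fin.ext hi
    exact ⟨j, fun h => hj (by rw [h, Fin.val_zero]), rfl⟩
  · rintro ⟨s, hs, rfl⟩
    exact ⟨0, s, rfl, fun h => hs (Fin.ext h), rfl⟩

theorem swap_zero_injective {N : ℕ} (v : Perm (Fin (N + 1))) :
    Function.Injective fun s : Fin (N + 1) => v * swap 0 s := fun s s' h => by
  simpa using congrArg (fun w : Perm (Fin (N + 1)) => w 0) h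

/-- A vertex in a copy of the `(k + 1)`-dimensional star graph has `k` neighbours. This is all the
lower bounds use about copies. -/
theorem EveryVertexInCopy.exists_neighbors {V : Type*} {k : ℕ} {G : SimpleGraph V}
    (h : EveryVertexInCopy (starGraph (k + 1)) G) (v : V) :
    ∃ f : Fin k → V, Function.Injective f ∧ ∀ i, G.Adj v (f i) := by
  obtain ⟨K, hv, ⟨e⟩⟩ := h v
  refine ⟨fun i => (e.symm (e ⟨v, hv⟩ * swap 0 i.succ)).1, fun i j hij => ?_, fun i => ?_⟩
  · exact Fin.succ_injective _ (swap_zero_injective _ (e.symm.injective (Subtype.ext hij)))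
  · have h1 : (starGraph (k + 1)).Adj (e ⟨v, hv⟩) (e ⟨v, hv⟩ * swap 0 i.succ) :=
      starGraph_adj.2 ⟨_, Fin.succ_ne_zero i, rfl⟩
    rw [← e.symm.map_adj_iff, e.symm_apply_apply] at h1
    exact K.adj_sub h1

theorem minDirections_of_neighbors {N k : ℕ} {C : Finset (Perm (Fin (N + 1)))}
    (h : ∀ v ∈ C, ∃ f : Fin k → Perm (Fin (N + 1)), Function.Injective f ∧
      ∀ i, (starGraph (N + 1)).Adj v (f i) ∧ f i ∈ C) : MinDirections 0 univ k C := by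
  intro v hv
  obtain ⟨f, hf, h1⟩ := h v hv
  choose s hs hfs using fun i => starGraph_adj.1 (h1 i).1
  have hinj : Function.Injective s := fun i j hij => hf (by rw [hfs, hfs, hij])
  rw [← card_fin k, ← card_image_of_injective univ hinj]
  refine card_le_card fun t ht => ?_
  obtain ⟨i, -, rfl⟩ := mem_image.1 ht
  exact mem_filter.2 ⟨mem_erase.2 ⟨hs i, mem_univ _⟩, hfs i ▸ (h1 i).2⟩

theorem starCoset_univ {α : Type*} [Fintype α] [DecidableEq α] (v₀ : Perm α) :
    starCoset univ v₀ = univ := by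
  ext v
  simp [mem_starCoset]

theorem le_encard_of_isEmbeddedVertexCut {N k : ℕ} {F : Set (Perm (Fin (N + 1)))}
    (hF : IsEmbeddedVertexCut (starGraph (k + 1)) (starGraph (N + 1)) F) :
    (((k + 1)! * (N + 1 - (k + 1)) : ℕ) : ℕ∞) ≤ F.encard := by
  classical
  obtain ⟨hdis, hcopy⟩ := hF
  set G := (starGraph (N + 1)).induce Fᶜ
  simp only [SimpleGraph.Preconnected, not_forall] at hdis
  obtain ⟨a, b, hab⟩ := hdis
  let C : Finset (Perm (Fin (N + 1))) := {v | ∃ h : v ∈ Fᶜ, G.Reachable a ⟨v, h⟩}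
  let D : Finset (Perm (Fin (N + 1))) := {v | ∃ h : v ∈ Fᶜ, ¬ G.Reachable a ⟨v, h⟩}
  have hC : ∀ v : (Fᶜ : Set (Perm (Fin (N + 1)))), v.1 ∈ C ↔ G.Reachable a v := fun v => by
    simp only [C, mem_filter, mem_univ, true_and]
    exact ⟨fun h => h.2, fun h => ⟨v.2, h⟩⟩
  have hD : ∀ v : (Fᶜ : Set (Perm (Fin (N + 1)))), v.1 ∈ D ↔ ¬ G.Reachable a v := fun v => by
    simp only [D, mem_filter, mem_univ, true_and]
    exact ⟨fun h => h.2, fun h => ⟨v.2, h⟩⟩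
  have hCF : ∀ v ∈ C, v ∈ Fᶜ := fun v hv => (mem_filter.1 hv).2.1
  have hDF : ∀ v ∈ D, v ∈ Fᶜ := fun v hv => (mem_filter.1 hv).2.1
  have hnot : ∀ v ∈ C, ∀ w ∈ D, ¬ (starGraph (N + 1)).Adj v w := fun v hv w hw hvw =>
    (hD ⟨w, hDF w hw⟩).1 hw (((hC ⟨v, hCF v hv⟩).1 hv).trans
      (SimpleGraph.Adj.reachable (G := G) (u := ⟨v, hCF v hv⟩) (v := ⟨w, hDF w hw⟩) hvw))
  have hCD : Disjoint C D :=
    disjoint_left.2 fun v hv hw => (hD ⟨v, hCF v hv⟩).1 hw ((hC ⟨v, hCF v hv⟩).1 hv)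
  have hCk : MinDirections 0 univ k C := minDirections_of_neighbors fun v hv => by
    obtain ⟨f, hf, h1⟩ := hcopy.exists_neighbors ⟨v, hCF v hv⟩
    exact ⟨fun i => (f i).1, Subtype.val_injective.comp hf, fun i =>
      ⟨h1 i, (hC _).2 (((hC ⟨v, hCF v hv⟩).1 hv).trans (h1 i).reachable)⟩⟩
  have hDk : MinDirections 0 univ k D := minDirections_of_neighbors fun v hv => by
    obtain ⟨f, hf, h1⟩ := hcopy.exists_neighbors ⟨v, hDF v hv⟩
    exact ⟨fun i => (f i).1, Subtype.val_injective.comp hf, fun i =>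
      ⟨h1 i, (hD _).2 fun h => (hD ⟨v, hDF v hv⟩).1 hv (h.trans (h1 i).reachable.symm)⟩⟩
  have hcost := factorial_mul_sub_le_mixedCost (z := 0) (B := univ) (v₀ := 1) k (mem_univ _)
    (by simp [starCoset_univ]) (by simp [starCoset_univ]) hCD
    ⟨a.1, (hC a).2 (SimpleGraph.Reachable.refl a)⟩ ⟨b.1, (hD b).2 hab⟩ hCk hDk
  rw [card_fin, mixedCost, starCoset_univ] at hcost
  have hzero : #{e ∈ C ×ˢ (univ : Finset (Fin (N + 1))).erase 0 | e.1 * swap 0 e.2 ∈ D} = 0 := by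
    rw [card_eq_zero, filter_eq_empty_iff]
    intro e he hw
    obtain ⟨h1, h2⟩ := mem_product.1 he
    exact hnot _ h1 _ hw (starGraph_adj.2 ⟨e.2, (mem_erase.1 h2).1, rfl⟩)
  rw [hzero, add_zero] at hcost
  refine (Nat.cast_le.2 hcost).trans ?_
  rw [← Set.encard_coe_eq_coe_finsetCard]
  refine Set.encard_le_encard fun v hv => ?_
  by_contra hvF
  rw [mem_coe, mem_sdiff, mem_union, not_or] at hv
  exact hv.2.2 ((hD ⟨v, hvF⟩).2 fun h => hv.2.1 ((hC ⟨v, hvF⟩).2 h))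

theorem le_encard_of_isEmbeddedEdgeCut {N k : ℕ} {F : Set (Sym2 (Perm (Fin (N + 1))))}
    (hF : IsEmbeddedEdgeCut (starGraph (k + 1)) (starGraph (N + 1)) F) :
    (((k + 1)! * (N + 1 - (k + 1)) : ℕ) : ℕ∞) ≤ F.encard := by
  classical
  obtain ⟨-, hdis, hcopy⟩ := hF
  set G := (starGraph (N + 1)).deleteEdges F with hG
  simp only [SimpleGraph.Preconnected, not_forall] at hdis
  obtain ⟨a, b, hab⟩ := hdis
  let C : Finset (Perm (Fin (N + 1))) := {v | G.Reachable a v}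
  let D : Finset (Perm (Fin (N + 1))) := {v | ¬ G.Reachable a v}
  have hC : ∀ v, v ∈ C ↔ G.Reachable a v := fun v => by simp [C]
  have hD : ∀ v, v ∈ D ↔ ¬ G.Reachable a v := fun v => by simp [D]
  have hCD : Disjoint C D := disjoint_left.2 fun v hv hw => (hD v).1 hw ((hC v).1 hv)
  have hle : G ≤ starGraph (N + 1) := SimpleGraph.deleteEdges_le F
  have hCk : MinDirections 0 univ k C := minDirections_of_neighbors fun v hv => by
    obtain ⟨f, hf, h1⟩ := hcopy.exists_neighbors v
    exact ⟨f, hf, fun i => ⟨hle (h1 i), (hC _).2 (((hC v).1 hv).trans (h1 i).reachable)⟩⟩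
  have hDk : MinDirections 0 univ k D := minDirections_of_neighbors fun v hv => by
    obtain ⟨f, hf, h1⟩ := hcopy.exists_neighbors v
    exact ⟨f, hf, fun i => ⟨hle (h1 i),
      (hD _).2 fun h => (hD v).1 hv (h.trans (h1 i).reachable.symm)⟩⟩
  have hcost := factorial_mul_sub_le_mixedCost (z := 0) (B := univ) (v₀ := 1) k (mem_univ _)
    (by simp [starCoset_univ]) (by simp [starCoset_univ]) hCD
    ⟨a, (hC a).2 (SimpleGraph.Reachable.refl a)⟩ ⟨b, (hD b).2 hab⟩ hCk hDk
  rw [card_fin, mixedCost, starCoset_univ] at hcost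
  have hzero : univ \ (C ∪ D) = ∅ := by
    rw [sdiff_eq_empty_iff_subset]
    intro v _
    rw [mem_union, hC, hD]
    exact em _
  rw [hzero, card_empty, zero_add] at hcost
  refine (Nat.cast_le.2 hcost).trans ?_
  rw [← Set.encard_coe_eq_coe_finsetCard]
  refine Set.encard_le_encard_of_injOn (f := fun e => s(e.1, e.1 * swap 0 e.2))
    (fun e he => ?_) fun e he e' he' hee => ?_
  · obtain ⟨h1, h2⟩ := mem_filter.1 he
    obtain ⟨h3, h4⟩ := mem_product.1 h1
    by_contra hF
    have hadj : G.Adj e.1 (e.1 * swap 0 e.2) := by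
      rw [hG, SimpleGraph.deleteEdges_adj]
      exact ⟨starGraph_adj.2 ⟨_, (mem_erase.1 h4).1, rfl⟩, hF⟩
    exact (hD _).1 h2 (((hC _).1 h3).trans hadj.reachable)
  · obtain ⟨h1, h2⟩ := mem_filter.1 he
    obtain ⟨h1', h2'⟩ := mem_filter.1 he'
    rcases Sym2.eq_iff.1 hee with ⟨h3, h4⟩ | ⟨h3, h4⟩
    · rw [h3] at h4
      exact Prod.ext h3 (swap_zero_injective _ h4)
    · exact absurd (h3 ▸ (mem_product.1 h1).1) fun h => disjoint_left.1 hCD h h2'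

/-! ### Copies and optimal cuts -/

/-- The first `k + 1` of `N + 1` positions. -/
def lowPositions {k N : ℕ} (h : k ≤ N) : Finset (Fin (N + 1)) :=
  univ.map (Fin.castLEEmb (Nat.succ_le_succ h))

theorem mem_lowPositions {k N : ℕ} (h : k ≤ N) {s : Fin (N + 1)} :
    s ∈ lowPositions h ↔ (s : ℕ) < k + 1 := by
  simp only [lowPositions, mem_map, mem_univ, true_and]
  constructor
  · rintro ⟨i, rfl⟩
    exact i.2
  · intro hs
    exact ⟨⟨s, hs⟩, rfl⟩

theorem card_lowPositions {k N : ℕ} (h : k ≤ N) : #(lowPositions h) = k + 1 := by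
  rw [lowPositions, card_map, card_fin]

theorem viaEmbedding_swap {β γ : Type*} [DecidableEq β] [DecidableEq γ] (e : β ↪ γ) (i j : β) :
    (swap i j).viaEmbedding e = swap (e i) (e j) := by
  ext x
  by_cases hx : x ∈ Set.range e
  · obtain ⟨y, rfl⟩ := hx
    rw [Perm.viaEmbedding_apply, e.injective.swap_apply]
  · rw [Perm.viaEmbedding_apply_of_notMem _ _ _ hx, swap_apply_of_ne_of_ne]
    · rintro rfl
      exact hx ⟨i, rfl⟩
    · rintro rfl
      exact hx ⟨j, rfl⟩

/-- An injection `e` of positions fixing the first one gives a copy, through `v`, of the star graph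
of dimension `k + 1`: the words that agree with `v` outside the range of `e`. The map `ι` places these
words in the vertex type of `G`, which may be a subtype of the words. -/
theorem exists_starGraph_copy {V : Type*} {G : SimpleGraph V} {k N : ℕ}
    (e : Fin (k + 1) ↪ Fin (N + 1)) (he : e 0 = 0) (v : Perm (Fin (N + 1)))
    (ι : ∀ w : Perm (Fin (N + 1)), (∀ s ∉ Set.range e, w s = v s) → V)
    (hι : ∀ w w' hw hw', ι w hw = ι w' hw' → w = w')
    (hadj : ∀ w hw t hw', t ∈ Set.range e → t ≠ 0 → G.Adj (ι w hw) (ι (w * swap 0 t) hw')) :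
    ∃ K : G.Subgraph, ι v (fun _ _ => rfl) ∈ K.verts ∧ Nonempty (K.coe ≃g starGraph (k + 1)) := by
  have hmem : ∀ π : Perm (Fin (k + 1)), ∀ s ∉ Set.range e, (v * π.viaEmbedding e) s = v s :=
    fun π s hs => by rw [Perm.mul_apply, Perm.viaEmbedding_apply_of_notMem _ _ _ hs]
  let f : (starGraph (k + 1)).Copy G := SimpleGraph.Copy.mk
    { toFun := fun π => ι (v * π.viaEmbedding e) (hmem π)
      map_rel' := by
        intro π ρ h
        obtain ⟨s, hs, rfl⟩ := starGraph_adj.1 h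
        have h1 : v * (π * swap 0 s).viaEmbedding e = v * π.viaEmbedding e * swap 0 (e s) := by
          rw [← Perm.viaEmbeddingHom_apply, map_mul, Perm.viaEmbeddingHom_apply,
            Perm.viaEmbeddingHom_apply, viaEmbedding_swap, he, mul_assoc]
        simp only [h1]
        exact hadj _ _ _ _ ⟨s, rfl⟩ fun h => hs (e.injective (h.trans he.symm)) }
    (fun π ρ h => Perm.viaEmbeddingHom_injective e (mul_left_cancel (hι _ _ _ _ h)))
  refine ⟨f.toSubgraph, ⟨1, trivial, ?_⟩, ⟨f.isoToSubgraph.symm⟩⟩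
  have h1 : v * (1 : Perm (Fin (k + 1))).viaEmbedding e = v := by
    rw [← Perm.viaEmbeddingHom_apply, map_one, mul_one]
  change ι (v * (1 : Perm (Fin (k + 1))).viaEmbedding e) _ = _
  simp only [h1]

theorem not_preconnected_of_closed {V : Type*} {G : SimpleGraph V} {S : Set V} {a b : V}
    (ha : a ∈ S) (hb : b ∉ S) (hS : ∀ v ∈ S, ∀ w, G.Adj v w → w ∈ S) : ¬ G.Preconnected := by
  intro h
  have h1 := (SimpleGraph.reachable_iff_reflTransGen a b).1 (h a b)
  have h2 : ∀ c, Relation.ReflTransGen G.Adj a c → c ∈ S := fun c hc => by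
    induction hc with
    | refl => exact ha
    | tail _ hbc ih => exact hS _ ih _ hbc
  exact hb (h2 b h1)

theorem range_castLEEmb {k N : ℕ} (h : k ≤ N) :
    Set.range (Fin.castLEEmb (Nat.succ_le_succ h)) = lowPositions h := by
  simp [lowPositions]

theorem zero_mem_lowPositions {k N : ℕ} (h : k ≤ N) : (0 : Fin (N + 1)) ∈ lowPositions h := by
  simp [mem_lowPositions]

/-- Removing the edges that leave the copy on the first `k + 1` positions cuts no edge inside any
coset of the symmetric group on these positions, so each vertex keeps its standard copy. -/
theorem exists_isEmbeddedEdgeCut {k N : ℕ} (h : k < N) :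
    ∃ F, IsEmbeddedEdgeCut (starGraph (k + 1)) (starGraph (N + 1)) F ∧
      F.encard ≤ (((k + 1)! * (N + 1 - (k + 1)) : ℕ) : ℕ∞) := by
  set B := lowPositions h.le with hB
  have h0 : (0 : Fin (N + 1)) ∈ B := zero_mem_lowPositions h.le
  let F : Finset (Sym2 (Perm (Fin (N + 1)))) :=
    (starCoset B 1 ×ˢ Bᶜ).image fun e => s(e.1, e.1 * swap 0 e.2)
  refine ⟨F, ⟨fun x hx => ?_, ?_, fun v => ?_⟩, ?_⟩
  · obtain ⟨e, he, rfl⟩ := mem_image.1 (mem_coe.1 hx)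
    refine starGraph_adj.2 ⟨e.2, ?_, rfl⟩
    intro h1
    exact mem_compl.1 (mem_product.1 he).2 (h1 ▸ h0)
  · refine not_preconnected_of_closed (S := starCoset B 1) (a := 1) (b := swap 0 (Fin.last N))
      (self_mem_starCoset B 1) ?_ fun v hv w hvw => ?_
    · intro h1
      have h2 := mem_starCoset.1 h1 (Fin.last N) (by simpa [hB, mem_lowPositions] using h)
      simp at h2
      omega
    · rw [SimpleGraph.deleteEdges_adj] at hvw
      obtain ⟨s, hs, rfl⟩ := starGraph_adj.1 hvw.1
      by_cases hsB : s ∈ B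
      · exact mul_swap_mem_starCoset hv h0 hsB
      · exact absurd (mem_coe.2 (mem_image.2 ⟨(v, s), mem_product.2 ⟨hv, mem_compl.2 hsB⟩, rfl⟩))
          hvw.2
  · refine exists_starGraph_copy (Fin.castLEEmb (Nat.succ_le_succ h.le)) rfl v
      (fun w _ => w) (fun w w' _ _ h => h) fun w hw t hw' ht ht0 => ?_
    rw [range_castLEEmb h.le, mem_coe] at ht
    rw [SimpleGraph.deleteEdges_adj]
    refine ⟨starGraph_adj.2 ⟨t, ht0, rfl⟩, fun hF => ?_⟩
    obtain ⟨⟨x, s⟩, hxs, heq⟩ := mem_image.1 (mem_coe.1 hF)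
    have hs := mem_compl.1 (mem_product.1 hxs).2
    suffices s = t from hs (this ▸ ht)
    rcases Sym2.eq_iff.1 heq with ⟨h1, h2⟩ | ⟨h1, h2⟩
    · simp only at h1 h2
      rw [h1] at h2
      exact swap_zero_injective _ h2
    · simp only at h1 h2
      rw [h1, mul_assoc, mul_eq_left] at h2
      have h3 := mul_eq_one_iff_eq_inv.1 h2
      rw [swap_inv] at h3
      exact (swap_zero_injective 1 (by simpa using h3)).symm
  · rw [Set.encard_coe_eq_coe_finsetCard, Nat.cast_le]
    refine card_image_le.trans ?_
    rw [card_product, card_starCoset, card_compl, card_lowPositions, Fintype.card_fin]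

/-- The outer neighbours of the copy on the first `k + 1` positions form an embedded vertex-cut. If the standard copy through `v` meets the deleted set, then some digit `j` whose own
position is not a low one stands in `v` at a low position `p ≠ 0`; the copy using position `j`
instead of `p` keeps the digit `j` at `p`, and so avoids the deleted set, whose words with a
misplaced digit `j` have it first. -/
theorem exists_isEmbeddedVertexCut {k N : ℕ} (h : k < N) (hN : 2 ≤ N) :
    ∃ F, IsEmbeddedVertexCut (starGraph (k + 1)) (starGraph (N + 1)) F ∧
      F.encard ≤ (((k + 1)! * (N + 1 - (k + 1)) : ℕ) : ℕ∞) := by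
  set B := lowPositions h.le with hB
  have h0 : (0 : Fin (N + 1)) ∈ B := zero_mem_lowPositions h.le
  let F : Finset (Perm (Fin (N + 1))) :=
    (starCoset B 1 ×ˢ Bᶜ).image fun e => e.1 * swap 0 e.2
  have hF : ∀ w, w ∈ F ↔ ∃ x ∈ starCoset B 1, ∃ j ∉ B, x * swap 0 j = w := fun w => by
    simp only [F, mem_image, Prod.exists, mem_product, mem_compl]
    exact ⟨fun ⟨x, j, ⟨h1, h2⟩, h3⟩ => ⟨x, h1, j, h2, h3⟩,
      fun ⟨x, h1, j, h2, h3⟩ => ⟨x, j, ⟨h1, h2⟩, h3⟩⟩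
  have hfix : ∀ x ∈ starCoset B 1, ∀ s ∉ B, x s = s := fun x hx s hs => mem_starCoset.1 hx s hs
  have hs0 : ∀ s ∉ B, s ≠ 0 := fun s hs h => hs (h ▸ h0)
  have h1F : (1 : Perm (Fin (N + 1))) ∉ F := by
    rw [hF]
    rintro ⟨x, hx, j, hj, h1⟩
    have h2 := congrArg (fun w : Perm (Fin (N + 1)) => w 0) h1
    simp only [Perm.mul_apply, swap_apply_left, Perm.one_apply, hfix x hx j hj] at h2
    exact hj (h2 ▸ h0)
  have hone : (1 : Fin (N + 1)) ≠ 0 := by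
    rw [Ne, Fin.ext_iff, Fin.val_one', Fin.val_zero, Nat.mod_eq_of_lt (by omega)]
    exact one_ne_zero
  have hlast : Fin.last N ∉ B := by simpa [hB, mem_lowPositions] using h
  have honelast : (1 : Fin (N + 1)) ≠ Fin.last N := by
    rw [Ne, Fin.ext_iff, Fin.val_one', Fin.val_last, Nat.mod_eq_of_lt (by omega)]
    omega
  -- A surviving word outside the copy; `2 ≤ N` makes the two swapped positions distinct.
  set b : Perm (Fin (N + 1)) := swap 1 (Fin.last N) with hb
  have hbF : b ∉ F := by
    rw [hF]
    rintro ⟨x, hx, j, hj, h1⟩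
    have h2 := congrArg (fun w : Perm (Fin (N + 1)) => w 0) h1
    simp only [Perm.mul_apply, swap_apply_left, hb, hfix x hx j hj] at h2
    rw [swap_apply_of_ne_of_ne hone.symm (hs0 _ hlast).symm] at h2
    exact hj (h2 ▸ h0)
  refine ⟨F, ⟨?_, fun v => ?_⟩, ?_⟩
  · refine not_preconnected_of_closed (S := {v | v.1 ∈ starCoset B 1}) (a := ⟨1, h1F⟩)
      (b := ⟨b, hbF⟩) (self_mem_starCoset B 1) ?_ fun v hv w hvw => ?_
    · intro h1
      have h2 := hfix _ h1 _ hlast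
      simp only [hb, swap_apply_right] at h2
      exact honelast h2
    · obtain ⟨s, hs, hw⟩ := starGraph_adj.1 (SimpleGraph.comap_adj.1 hvw)
      change w.1 ∈ starCoset B 1
      change w.1 = v.1 * _ at hw
      by_cases hsB : s ∈ B
      · rw [hw]
        exact mul_swap_mem_starCoset hv h0 hsB
      · exact absurd ((hF _).2 ⟨v.1, hv, s, hsB, hw.symm⟩) w.2
  · obtain ⟨v, hv⟩ := v
    have hvF : v ∉ F := hv
    by_cases hstd : ∀ w : Perm (Fin (N + 1)), (∀ s ∉ B, w s = v s) → w ∉ F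
    · refine exists_starGraph_copy (Fin.castLEEmb (Nat.succ_le_succ h.le)) rfl v
        (fun w hw => ⟨w, hstd w (by simpa only [range_castLEEmb h.le, mem_coe] using hw)⟩)
        (fun w w' _ _ h => congrArg Subtype.val h) fun w hw t hw' ht ht0 => ?_
      exact starGraph_adj.2 ⟨t, ht0, rfl⟩
    · -- Some word `x * swap 0 j` of the standard copy is deleted, which locates the digit `j` in `v`.
      push Not at hstd
      obtain ⟨w, hw, hwF⟩ := hstd
      obtain ⟨x, hx, j, hj, rfl⟩ := (hF _).1 hwF
      have hvs : ∀ s ∉ B, s ≠ j → v s = s := fun s hs hsj => by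
        rw [← hw s hs, Perm.mul_apply, swap_apply_of_ne_of_ne (hs0 s hs) hsj,
          hfix x hx s hs]
      obtain ⟨p, hp⟩ := v.surjective j
      have hpj : p ≠ j := by
        rintro rfl
        have h1 := hw p hj
        rw [hp, Perm.mul_apply, swap_apply_right] at h1
        have h2 := x.injective (h1.trans (hfix x hx p hj).symm)
        exact hj (h2 ▸ h0)
      have hpB : p ∈ B := by
        by_contra hpB
        exact hpj ((hvs p hpB hpj).symm.trans hp)
      have hp0 : p ≠ 0 := by
        rintro rfl
        refine hvF ((hF _).2 ⟨v * swap 0 j, mem_starCoset.2 fun s hs => ?_, j, hj,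
          by simp [mul_assoc]⟩)
        rw [Perm.one_apply, Perm.mul_apply]
        by_cases hsj : s = j
        · rw [hsj, swap_apply_right, hp]
        · rw [swap_apply_of_ne_of_ne (hs0 s hs) hsj, hvs s hs hsj]
      let e : Fin (k + 1) ↪ Fin (N + 1) :=
        (Fin.castLEEmb (Nat.succ_le_succ h.le)).trans (swap p j).toEmbedding
      have hpe : p ∉ Set.range e := by
        rintro ⟨i, hi⟩
        have h1 : swap p j (Fin.castLEEmb (Nat.succ_le_succ h.le) i) = p := hi
        rw [swap_apply_eq_iff, swap_apply_left] at h1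
        exact hj (mem_map.2 ⟨i, mem_univ _, h1⟩)
      have hcopy : ∀ w : Perm (Fin (N + 1)), (∀ s ∉ Set.range e, w s = v s) → w ∉ F := by
        intro w hw hwF'
        obtain ⟨x', hx', j', hj', rfl⟩ := (hF _).1 hwF'
        have h1 := hw p hpe
        rw [hp, Perm.mul_apply, swap_apply_of_ne_of_ne hp0 (ne_of_mem_of_not_mem hpB hj')] at h1
        exact hpj (x'.injective (h1.trans (hfix x' hx' j hj).symm))
      refine exists_starGraph_copy e (swap_apply_of_ne_of_ne hp0.symm (hs0 j hj).symm) v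
        (fun w hw => ⟨w, hcopy w hw⟩)
        (fun w w' _ _ h => congrArg Subtype.val h) fun w hw t hw' ht ht0 => ?_
      exact starGraph_adj.2 ⟨t, ht0, rfl⟩
  · rw [Set.encard_coe_eq_coe_finsetCard, Nat.cast_le]
    refine card_image_le.trans ?_
    rw [card_product, card_starCoset, card_compl, card_lowPositions, Fintype.card_fin]

theorem theorem3p6 (n h : ℕ) (h_pos : 1 ≤ h) (h_le : h ≤ n - 1) :
    (3 ≤ n → zetaStar h n = ((h ! * (n - h) : ℕ) : ℕ∞)) ∧
      etaStar h n = ((h ! * (n - h) : ℕ) : ℕ∞) := by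
  obtain ⟨k, rfl⟩ : ∃ k, h = k + 1 := ⟨h - 1, by omega⟩
  obtain ⟨N, rfl⟩ : ∃ N, n = N + 1 := ⟨n - 1, by omega⟩
  have hk : k < N := by omega
  refine ⟨fun hn => le_antisymm ?_ ?_, le_antisymm ?_ ?_⟩
  · obtain ⟨F, hF, hcard⟩ := exists_isEmbeddedVertexCut hk (by omega)
    exact (iInf₂_le F hF).trans hcard
  · exact le_iInf₂ fun F hF => le_encard_of_isEmbeddedVertexCut hF
  · obtain ⟨F, hF, hcard⟩ := exists_isEmbeddedEdgeCut hk
    exact (iInf₂_le F hF).trans hcard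
  · exact le_iInf₂ fun F hF => le_encard_of_isEmbeddedEdgeCut hF
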